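/- Consider a leader $x_r(k+1)=Sx_r(k)$, $y_r(k)=Rx_r(k)$ with known $S\in\mathbb{R}^{r\times r}$, $R\in\mathbb{R}^{p\times r}$, and $N$ followers $x_i(k+1)=\bar A_ix_i(k)+\bar B_iu_i(k)$, $y_i(k)=C_ix_i(k)+D_iu_i(k)$, $i=1,\dots,N$, with $x_i(k)\in\mathbb{R}^{n_i}$, $n_i\ge 1$, $u_i(k)\in\mathbb{R}^{m_i}$, known $C_i,D_i$ and unknown $\bar A_i,\bar B_i$. From each follower one has the data $U_{i-}=[u_i(0)\ \cdots\ u_i(\tau-1)]$ and $X_i=[x_i(0)\ \cdots\ x_i(\tau)]$; put $X_{i-}=[x_i(0)\ \cdots\ x_i(\tau-1)]$ and $X_{i+}=[x_i(1)\ \cdots\ x_i(\tau)]$, so that $X_{i+}=\bar A_iX_{i-}+\bar B_iU_{i-}$. Let $\Sigma_i$ be the set of all $(A_i,B_i)$ with $X_{i+}=A_iX_{i-}+B_iU_{i-}$. Let $\mathcal{A}=[a_{ij}]$ be the nonnegative adjacency matrix of the weighted directed communication graph between the followers ($a_{ji}\neq0$ iff $(i,j)$ is an edge), $d_i=\sum_j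 a_{ij}$, $\mathcal{D}=\mathrm{diag}(d_1,\dots,d_N)$, $L=\mathcal{D}-\mathcal{A}$, and let $g_i\ge 0$ be the weight with which the leader shares its state with follower $i$, $G=\mathrm{diag}(g_1,\dots,g_N)$. A protocol is given by matrices $F,K_i,\Pi_i,\Gamma_i$ and reads $$v_i(k+1)=Sv_i(k)+(1+d_i+g_i)^{-1}F\Big(\sum_{j=1}^N a_{ij}\big(v_j(k)-v_i(k)\big)+g_i\big(x_r(k)-v_i(k)\big)\Big),$$ $$u_i(k)=K_i\big(x_i(k)-\Pi_iv_i(k)\big)+\Gamma_iv_i(k).$$ It achieves output synchronization for followers $(A_i,B_i)$ if, for all initial states and all $i$, $y_i(k)-y_r(k)\to0$, $v_i(k)-x_r(k)\to0$ and $x_i(k)-\Pi_iv_i(k)\to0$ as $k\to\infty$. The data $(U_{i-},X_i)$, $i=1,\dots,N$, are informative for output synchronization if there is a single protocol that achieves output synchronization for all choices of $(A_i,B_i)\in\Sigma_i$, $i=1,\dots,N$. A square matrix is stable if all its eigenvalues lie in the open unit disc. Assume that (1) all eigenvalues of $S$ are simple and lie on the unit circle, and (2) the communication graph between the followers has no self-loops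 and contains a directed spanning tree, and $g_i>0$ for at least one node $i$ that is the root of a spanning tree. Then the data $(U_{i-},X_i)$ are informative for output synchronization if and only if, for each $i=1,\dots,N$, there is a right inverse $X_{i-}^\dagger$ of $X_{i-}$ such that $X_{i+}X_{i-}^\dagger$ is stable, and there is a matrix $M_i$ with $$X_{i+}M_i-X_{i-}M_iS=0,\qquad C_iX_{i-}M_i+D_iU_{i-}M_i=R.$$ In this case a protocol can be found as follows. There exist matrices $F$ such that $S-\lambda F$ is stable for every eigenvalue $\lambda$ of $(I_N+\mathcal{D}+G)^{-1}(L+G)$; for any such $F$ and any $X_{i-}^\dagger$, $M_i$ as above, the protocol with this $F$ and $K_i=U_{i-}X_{i-}^\dagger$, $\Pi_i=X_{i-}M_i$, $\Gamma_i=U_{i-}M_i$ achieves output synchronization for all $(A_i,B_i)\in\Sigma_i$, $i=1,\dots,N$. -/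

import Mathlib

open Filter Topology

/-- A square complex matrix is (Schur) stable if all its eigenvalues lie in the open unit disc. -/
def IsSchurStable {d : ℕ} (A : Matrix (Fin d) (Fin d) ℂ) : Prop :=
  ∀ z ∈ spectrum ℂ A, ‖z‖ < 1

/-- A real matrix, regarded as a complex matrix. -/
def toComplex {a b : ℕ} (A : Matrix (Fin a) (Fin b) ℝ) : Matrix (Fin a) (Fin b) ℂ :=
  A.map Complex.ofReal

/-- All (complex) eigenvalues of `S` are simple, as roots of the characteristic polynomial, and
lie on the unit circle. -/
def EigenvaluesSimpleOnUnitCircle {r : ℕ} (S : Matrix (Fin r) (Fin r) ℝ) : Prop :=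
  ∀ z ∈ spectrum ℂ (toComplex S),
    (toComplex S).charpoly.rootMultiplicity z = 1 ∧ ‖z‖ = 1

/-- A weighted directed graph on `N` nodes, given by its adjacency matrix `[a_{ij}]`, which has
nonnegative entries. -/
structure WeightedDigraph (N : ℕ) where
  adj : Matrix (Fin N) (Fin N) ℝ
  adj_nonneg : ∀ i j, 0 ≤ adj i j

namespace WeightedDigraph

variable {N : ℕ} (G : WeightedDigraph N)

/-- `(i, j)` is an edge iff its weight `a_{ji}` is nonzero. -/
def Edge (i j : Fin N) : Prop := G.adj j i ≠ 0

/-- No self-loops. -/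
def IsSimple : Prop := ∀ i, G.adj i i = 0

/-- The degree `d_i = ∑_j a_{ij}`. -/
def degree (i : Fin N) : ℝ := ∑ j, G.adj i j

/-- The degree matrix `diag(d_1, …, d_N)`. -/
def degreeMatrix : Matrix (Fin N) (Fin N) ℝ := Matrix.diagonal G.degree

/-- The Laplacian matrix. -/
def laplacian : Matrix (Fin N) (Fin N) ℝ := G.degreeMatrix - G.adj

/-- The edge relation `T` is a spanning tree of `G` with root `root`: all its edges are edges of
`G`, the root has in-degree zero, every other node has in-degree one, and all nodes are connected
(by a directed path of `T` from the root). -/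
structure IsSpanningTree (T : Fin N → Fin N → Prop) (root : Fin N) : Prop where
  edge : ∀ i j, T i j → G.Edge i j
  root_indegree : ∀ i, ¬ T i root
  indegree : ∀ j, j ≠ root → ∃! i, T i j
  reachable : ∀ j, Relation.ReflTransGen T root j

end WeightedDigraph

/-- The known part of a leader-follower multi-agent system with `N` followers, followers' state
and input dimensions `n i`, `m i`, leader's state dimension `r` and output dimension `p`:
leader `x_r(k+1) = S x_r(k)`, `y_r = R x_r`; follower outputs `y_i = C_i x_i + D_i u_i`;
communication graph among the followers, and the weights `g_i ≥ 0` with which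
the leader shares its state with follower `i`. -/
structure LeaderFollowerNetwork (N r p : ℕ) (n m : Fin N → ℕ) where
  S : Matrix (Fin r) (Fin r) ℝ
  R : Matrix (Fin p) (Fin r) ℝ
  C : ∀ i, Matrix (Fin p) (Fin (n i)) ℝ
  D : ∀ i, Matrix (Fin p) (Fin (m i)) ℝ
  graph : WeightedDigraph N
  g : Fin N → ℝ
  g_nonneg : ∀ i, 0 ≤ g i

/-- The matrices to be chosen in the protocol: the common gain `F` and, for each follower,
`K_i`, `Π_i` (here `Pi i`) and `Γ_i` (here `Gam i`). -/
structure Protocol (N r : ℕ) (n m : Fin N → ℕ) where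
  F : Matrix (Fin r) (Fin r) ℝ
  K : ∀ i, Matrix (Fin (m i)) (Fin (n i)) ℝ
  Pi : ∀ i, Matrix (Fin (n i)) (Fin r) ℝ
  Gam : ∀ i, Matrix (Fin (m i)) (Fin r) ℝ

/-- `X_-`: the state data without the last column. -/
def pastStates {d τ : ℕ} (X : Matrix (Fin d) (Fin (τ + 1)) ℝ) : Matrix (Fin d) (Fin τ) ℝ :=
  X.submatrix id Fin.castSucc

/-- `X_+`: the state data without the first column. -/
def futureStates {d τ : ℕ} (X : Matrix (Fin d) (Fin (τ + 1)) ℝ) : Matrix (Fin d) (Fin τ) ℝ :=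
  X.submatrix id Fin.succ

/-- The set of all systems `(A, B)` that explain the input-state data `(U_-, X)`. -/
def explainingSystems {d e τ : ℕ} (U : Matrix (Fin e) (Fin τ) ℝ)
    (X : Matrix (Fin d) (Fin (τ + 1)) ℝ) :
    Set (Matrix (Fin d) (Fin d) ℝ × Matrix (Fin d) (Fin e) ℝ) :=
  {AB | futureStates X = AB.1 * pastStates X + AB.2 * U}

namespace LeaderFollowerNetwork

variable {N r p : ℕ} {n m : Fin N → ℕ} (net : LeaderFollowerNetwork N r p n m)

/-- The followers' graph is simple and contains a spanning tree, and the leader shares its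
information with at least one root node, i.e. with the root of some spanning tree. -/
def CommunicationAssumption : Prop :=
  net.graph.IsSimple ∧ ∃ T root, net.graph.IsSpanningTree T root ∧ 0 < net.g root

/-- The matrix `(I + 𝒟 + G)⁻¹ (L + G)` with `G = diag(g_1, …, g_N)`. -/
noncomputable def couplingMatrix : Matrix (Fin N) (Fin N) ℝ :=
  (1 + net.graph.degreeMatrix + Matrix.diagonal net.g)⁻¹ *
    (net.graph.laplacian + Matrix.diagonal net.g)

/-- `S - λ F` is stable for every eigenvalue `λ` of `(I + 𝒟 + G)⁻¹ (L + G)`. -/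
def IsStabilizingGain (F : Matrix (Fin r) (Fin r) ℝ) : Prop :=
  ∀ z ∈ spectrum ℂ (toComplex net.couplingMatrix),
    IsSchurStable (toComplex net.S - z • toComplex F)

/-- The sequences `xr`, `x`, `u`, `v` (leader state, follower states, follower inputs, controller
states) form a trajectory of the leader and the followers `x_i(k+1) = A_i x_i(k) + B_i u_i(k)`,
interconnected by the protocol `P`. The initial states are arbitrary. -/
structure IsTrajectory (P : Protocol N r n m)
    (A : ∀ i, Matrix (Fin (n i)) (Fin (n i)) ℝ) (B : ∀ i, Matrix (Fin (n i)) (Fin (m i)) ℝ)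
    (xr : ℕ → Fin r → ℝ) (x : ∀ i, ℕ → Fin (n i) → ℝ) (u : ∀ i, ℕ → Fin (m i) → ℝ)
    (v : Fin N → ℕ → Fin r → ℝ) : Prop where
  leader : ∀ k, xr (k + 1) = net.S.mulVec (xr k)
  follower : ∀ i k, x i (k + 1) = (A i).mulVec (x i k) + (B i).mulVec (u i k)
  controller : ∀ i k, v i (k + 1) = net.S.mulVec (v i k) +
    (1 + net.graph.degree i + net.g i)⁻¹ • P.F.mulVec
      ((∑ j, net.graph.adj i j • (v j k - v i k)) + net.g i • (xr k - v i k))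
  input : ∀ i k, u i k =
    (P.K i).mulVec (x i k - (P.Pi i).mulVec (v i k)) + (P.Gam i).mulVec (v i k)

/-- The protocol `P` achieves output synchronization for the leader and the followers `(A_i, B_i)`:
along all trajectories, `y_i - y_r`, `v_i - x_r` and `x_i - Π_i v_i` tend to zero. -/
def AchievesOutputSync (P : Protocol N r n m)
    (A : ∀ i, Matrix (Fin (n i)) (Fin (n i)) ℝ)
    (B : ∀ i, Matrix (Fin (n i)) (Fin (m i)) ℝ) : Prop :=
  ∀ xr x u v, net.IsTrajectory P A B xr x u v → ∀ i,
    Tendsto (fun k => ((net.C i).mulVec (x i k) + (net.D i).mulVec (u i k))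
      - net.R.mulVec (xr k)) atTop (𝓝 0) ∧
    Tendsto (fun k => v i k - xr k) atTop (𝓝 0) ∧
    Tendsto (fun k => x i k - (P.Pi i).mulVec (v i k)) atTop (𝓝 0)

/-- The protocol `P` achieves output synchronization for the leader and all follower systems that
explain the data. -/
def AchievesOutputSyncForData {τ : ℕ} (U : ∀ i, Matrix (Fin (m i)) (Fin τ) ℝ)
    (X : ∀ i, Matrix (Fin (n i)) (Fin (τ + 1)) ℝ) (P : Protocol N r n m) : Prop :=
  ∀ A B, (∀ i, (A i, B i) ∈ explainingSystems (U i) (X i)) → net.AchievesOutputSync P A B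

/-- The data `(U_{i-}, X_i)` are informative for output synchronization. -/
def InformativeForOutputSync {τ : ℕ} (U : ∀ i, Matrix (Fin (m i)) (Fin τ) ℝ)
    (X : ∀ i, Matrix (Fin (n i)) (Fin (τ + 1)) ℝ) : Prop :=
  ∃ P : Protocol N r n m, net.AchievesOutputSyncForData U X P

end LeaderFollowerNetwork

/-- `Xd` is a right inverse of `X_-` such that `X_+ Xd` is stable. -/
def IsStabilizingRightInverse {d τ : ℕ} (X : Matrix (Fin d) (Fin (τ + 1)) ℝ)
    (Xd : Matrix (Fin τ) (Fin d) ℝ) : Prop :=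
  pastStates X * Xd = 1 ∧ IsSchurStable (toComplex (futureStates X * Xd))

/-- `M` solves `X_+ M - X_- M S = 0` and `C X_- M + D U_- M = R`. -/
def SolvesDataRegulatorEquations {d e r p τ : ℕ} (S : Matrix (Fin r) (Fin r) ℝ)
    (R : Matrix (Fin p) (Fin r) ℝ) (C : Matrix (Fin p) (Fin d) ℝ) (D : Matrix (Fin p) (Fin e) ℝ)
    (U : Matrix (Fin e) (Fin τ) ℝ) (X : Matrix (Fin d) (Fin (τ + 1)) ℝ)
    (M : Matrix (Fin τ) (Fin r) ℝ) : Prop :=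
  futureStates X * M - pastStates X * M * S = 0 ∧
    C * pastStates X * M + D * U * M = R

/-! Sufficiency: write δ_j = v_j - x_r and e_i = x_i - Π_i v_i. The regulator equations AΠ + BΓ =
ΠS, CΠ + DΓ = R cancel every other signal, so e_i evolves under A + BK and is driven by δ, while δ
evolves autonomously under a map whose eigenvalues are eigenvalues of S - λF
(`norm_lt_one_of_hasEigenvalue_applyRows_sub`, `tendsto_zero_of_cascade`). Since X_+ = A X_- + B U_-
for every explaining system, the data conditions give stability and the regulator equations for all
of them at once. A gain exists because F = S works: a maximum principle on the graph gives |1 - λ| <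
1.

Necessity: trajectories with v_i = x_r force A + BK to be stable and, as S has no eigenvalue inside
the unit disc, force the regulator equations (`eq_zero_of_tendsto_mul_pow`). These hold for all of
Σ_i with one protocol. Hence every (a, b) with aX_- + bU_- = 0 also satisfies aΠ + bΓ = 0 and, by a
trace bound, a + bK = 0 (`eq_zero_of_isSchurStable_add_mul`). By duality the columns of [I; K] and
[Π; Γ] lie in the range of [X_-; U_-], which yields the right inverse and M. -/

/-! ### Powers of matrices and the location of eigenvalues -/

theorem tendsto_pow_apply_zero_of_eigenvalue_norm_lt_one {V : Type*} [NormedAddCommGroup V]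
    [NormedSpace ℂ V] [FiniteDimensional ℂ V] (f : Module.End ℂ V)
    (hf : ∀ z, f.HasEigenvalue z → ‖z‖ < 1) (x : V) :
    Tendsto (fun k : ℕ => (f ^ k) x) atTop (𝓝 0) := by
  have : CompleteSpace V := FiniteDimensional.complete ℂ V
  rcases subsingleton_or_nontrivial V with hV | hV
  · have : (fun k : ℕ => (f ^ k) x) = fun _ => 0 := funext fun k => Subsingleton.elim _ _
    rw [this]
    exact tendsto_const_nhds
  set φ := Module.End.toContinuousLinearMap (𝕜 := ℂ) V
  have hspec : ∀ z ∈ spectrum ℂ (φ f), ‖z‖₊ < 1 := by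
    intro z hz
    rw [AlgEquiv.spectrum_eq, ← Module.End.hasEigenvalue_iff_mem_spectrum] at hz
    exact hf z hz
  -- Gelfand's formula: any c strictly between the spectral radius and 1 eventually bounds the k-th
  -- root of ‖f ^ k‖.
  have hrad := spectrum.spectralRadius_lt_of_forall_lt (φ f) hspec
  obtain ⟨c, hc1, hc2⟩ := exists_between hrad
  lift c to NNReal using (hc2.trans ENNReal.coe_lt_top).ne
  have hc : c < 1 := by exact_mod_cast hc2
  have hev := (spectrum.pow_nnnorm_pow_one_div_tendsto_nhds_spectralRadius (φ f)).eventually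
    (gt_mem_nhds hc1)
  have hbound : ∀ᶠ k : ℕ in atTop, ‖(f ^ k) x‖ ≤ (c : ℝ) ^ k * ‖x‖ := by
    filter_upwards [hev, eventually_gt_atTop 0] with k hk hk0
    have h1 : (‖φ f ^ k‖₊ : ENNReal) ≤ (c : ENNReal) ^ k := by
      have h2 := ENNReal.rpow_le_rpow hk.le (Nat.cast_nonneg (α := ℝ) k)
      rwa [← ENNReal.rpow_mul, one_div, inv_mul_cancel₀ (by positivity), ENNReal.rpow_one,
        ENNReal.rpow_natCast] at h2
    have h3 : ‖φ f ^ k‖₊ ≤ c ^ k := by exact_mod_cast h1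
    have h4 : ‖φ f ^ k‖ ≤ (c : ℝ) ^ k := by exact_mod_cast h3
    have h5 : (f ^ k) x = (φ f ^ k) x := by
      rw [← map_pow]
      rfl
    rw [h5]
    exact ((φ f ^ k).le_opNorm x).trans (by gcongr)
  refine squeeze_zero_norm' hbound ?_
  simpa using (tendsto_pow_atTop_nhds_zero_of_lt_one c.2 (by exact_mod_cast hc)).mul_const ‖x‖

theorem Matrix.mem_spectrum_iff_exists_mulVec {ι : Type*} [Fintype ι] [DecidableEq ι]
    {A : Matrix ι ι ℂ} {z : ℂ} : z ∈ spectrum ℂ A ↔ ∃ w, w ≠ 0 ∧ A.mulVec w = z • w := by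
  rw [← Matrix.spectrum_toLin', ← Module.End.hasEigenvalue_iff_mem_spectrum]
  constructor
  · intro h
    obtain ⟨w, hw⟩ := h.exists_hasEigenvector
    exact ⟨w, hw.2, by simpa using hw.apply_eq_smul⟩
  · rintro ⟨w, hw, h⟩
    exact Module.End.hasEigenvalue_of_hasEigenvector
      (Module.End.hasEigenvector_iff.2 ⟨Module.End.mem_eigenspace_iff.2 (by simpa using h), hw⟩)

theorem Matrix.pow_mulVec_eigenvector {ι : Type*} [Fintype ι] [DecidableEq ι]
    {A : Matrix ι ι ℂ} {z : ℂ} {w : ι → ℂ} (h : A.mulVec w = z • w) (k : ℕ) :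
    (A ^ k).mulVec w = z ^ k • w := by
  induction k with
  | zero => simp
  | succ k ih =>
    rw [pow_succ, ← Matrix.mulVec_mulVec, h, Matrix.mulVec_smul, ih, smul_smul, pow_succ']

theorem norm_lt_one_of_tendsto_pow_smul {V : Type*} [NormedAddCommGroup V] [NormedSpace ℂ V]
    {z : ℂ} {w : V} (hw : w ≠ 0) (h : Tendsto (fun k : ℕ => z ^ k • w) atTop (𝓝 0)) :
    ‖z‖ < 1 := by
  have h1 := (h.norm.mul_const ‖w‖⁻¹)
  have hw' : ‖w‖ ≠ 0 := norm_ne_zero_iff.2 hw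
  simp only [norm_smul, norm_pow, norm_zero, zero_mul, mul_assoc, mul_inv_cancel₀ hw',
    mul_one] at h1
  simpa using tendsto_pow_atTop_nhds_zero_iff.1 h1

theorem toComplex_mulVec {a b : ℕ} (A : Matrix (Fin a) (Fin b) ℝ) (x : Fin b → ℝ) :
    (toComplex A).mulVec (fun j => (x j : ℂ)) = fun i => ((A.mulVec x i : ℝ) : ℂ) := by
  ext i
  exact (RingHom.map_mulVec Complex.ofRealHom A x i).symm

theorem toComplex_mul {a b c : ℕ} (A : Matrix (Fin a) (Fin b) ℝ) (B : Matrix (Fin b) (Fin c) ℝ) :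
    toComplex (A * B) = toComplex A * toComplex B :=
  Matrix.map_mul (f := Complex.ofRealHom)

theorem toComplex_pow {a : ℕ} (A : Matrix (Fin a) (Fin a) ℝ) (k : ℕ) :
    toComplex (A ^ k) = toComplex A ^ k :=
  map_pow (Complex.ofRealHom.mapMatrix (m := Fin a)) A k

theorem tendsto_mul_pow_apply {a d : ℕ} {E : Matrix (Fin a) (Fin d) ℝ}
    {A : Matrix (Fin d) (Fin d) ℝ}
    (h : ∀ x, Tendsto (fun k : ℕ => E.mulVec ((A ^ k).mulVec x)) atTop (𝓝 0))
    (i : Fin a) (j : Fin d) :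
    Tendsto (fun k : ℕ => (toComplex E * toComplex A ^ k) i j) atTop (𝓝 0) := by
  have h1 := tendsto_pi_nhds.1 (h (Pi.single j 1)) i
  have h2 := (Complex.continuous_ofReal.tendsto 0).comp h1
  simp only [Complex.ofReal_zero] at h2
  refine h2.congr fun k => ?_
  rw [← toComplex_pow, ← toComplex_mul]
  simp only [toComplex, Function.comp, Matrix.mulVec_single_one]
  rfl

theorem isSchurStable_toComplex_of_tendsto {d : ℕ} {A : Matrix (Fin d) (Fin d) ℝ}
    (h : ∀ x, Tendsto (fun k : ℕ => (A ^ k).mulVec x) atTop (𝓝 0)) :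
    IsSchurStable (toComplex A) := by
  intro z hz
  obtain ⟨w, hw, hzw⟩ := Matrix.mem_spectrum_iff_exists_mulVec.1 hz
  refine norm_lt_one_of_tendsto_pow_smul hw ?_
  have h1 := tendsto_mul_pow_apply (E := (1 : Matrix (Fin d) (Fin d) ℝ)) (A := A)
    (fun x => by simpa only [Matrix.one_mulVec] using h x)
  have h0 : toComplex (1 : Matrix (Fin d) (Fin d) ℝ) = 1 :=
    Matrix.map_one _ Complex.ofReal_zero Complex.ofReal_one
  simp only [h0, one_mul] at h1
  refine tendsto_pi_nhds.2 fun i => ?_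
  have h2 := tendsto_finsetSum Finset.univ fun j _ => (h1 i j).mul_const (w j)
  simp only [zero_mul, Finset.sum_const_zero] at h2
  refine h2.congr fun k => ?_
  rw [← Matrix.pow_mulVec_eigenvector hzw]
  rfl

/-- The row vectors killed asymptotically by powers of S form an invariant subspace of the
transpose. If nonzero, it would contain an eigenvector, whose eigenvalue would have modulus below 1.
The rows of E lie in this subspace. -/
theorem eq_zero_of_tendsto_mul_pow {a d : ℕ} {E : Matrix (Fin a) (Fin d) ℝ}
    {S : Matrix (Fin d) (Fin d) ℝ} (hS : ∀ z ∈ spectrum ℂ (toComplex S), 1 ≤ ‖z‖)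
    (h : ∀ x, Tendsto (fun k : ℕ => E.mulVec ((S ^ k).mulVec x)) atTop (𝓝 0)) :
    E = 0 := by
  set T := toComplex S
  let W : Submodule ℂ (Fin d → ℂ) :=
    { carrier := {φ | Tendsto (fun k : ℕ => ((T ^ k).transpose).mulVec φ) atTop (𝓝 0)}
      add_mem' := fun {φ ψ} hφ hψ => by
        simpa [Matrix.mulVec_add] using Tendsto.add (a := 0) (b := 0) hφ hψ
      zero_mem' := by simp
      smul_mem' := fun c φ hφ => by
        simpa [Matrix.mulVec_smul] using Tendsto.const_smul (a := 0) hφ c }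
  have hW : W = ⊥ := by
    by_contra hne
    have : Nontrivial W := Submodule.nontrivial_iff_ne_bot.2 hne
    have hinv : ∀ φ ∈ W, Matrix.toLin' T.transpose φ ∈ W := by
      intro φ hφ
      have h1 := (tendsto_add_atTop_iff_nat 1).2 hφ
      refine Tendsto.congr (fun k => ?_) h1
      rw [pow_succ', Matrix.transpose_mul, ← Matrix.mulVec_mulVec, Matrix.toLin'_apply]
    obtain ⟨z, hz⟩ := Module.End.exists_eigenvalue ((Matrix.toLin' T.transpose).restrict hinv)
    obtain ⟨φ, hφ⟩ := hz.exists_hasEigenvector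
    have hφ0 : (φ : Fin d → ℂ) ≠ 0 := fun h0 => hφ.2 (Subtype.ext h0)
    have heq : T.transpose.mulVec φ = z • (φ : Fin d → ℂ) := by
      simpa using congrArg Subtype.val hφ.apply_eq_smul
    have hlt : ‖z‖ < 1 := by
      refine norm_lt_one_of_tendsto_pow_smul hφ0 (Tendsto.congr (fun k => ?_) φ.2)
      rw [Matrix.transpose_pow, Matrix.pow_mulVec_eigenvector heq]
    have hmem : z ∈ spectrum ℂ T := by
      have := Matrix.mem_spectrum_iff_exists_mulVec.2 ⟨_, hφ0, heq⟩
      rwa [Matrix.mem_spectrum_iff_isRoot_charpoly, Matrix.charpoly_transpose,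
        ← Matrix.mem_spectrum_iff_isRoot_charpoly] at this
    exact absurd (hS z hmem) (not_le.2 hlt)
  ext i j
  have hmem : (fun j => ((E i j : ℝ) : ℂ)) ∈ W := by
    refine tendsto_pi_nhds.2 fun j => ?_
    refine (tendsto_mul_pow_apply h i j).congr fun k => ?_
    rw [Matrix.mulVec_transpose]
    rfl
  rw [hW, Submodule.mem_bot] at hmem
  simpa using congrFun hmem j

/-! ### Rigidity under perturbation, and duality -/

theorem IsSchurStable.norm_trace_le {d : ℕ} {A : Matrix (Fin d) (Fin d) ℂ}
    (hA : IsSchurStable A) : ‖A.trace‖ ≤ d := by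
  rw [Matrix.trace_eq_sum_roots_charpoly]
  refine (norm_multiset_sum_le _).trans ?_
  refine (Multiset.sum_le_card_nsmul _ 1 ?_).trans ?_
  · intro x hx
    obtain ⟨z, hz, rfl⟩ := Multiset.mem_map.1 hx
    exact (hA z (Matrix.mem_spectrum_iff_isRoot_charpoly.2 (Polynomial.isRoot_of_mem_roots hz))).le
  · have := A.charpoly.card_roots'
    rw [Matrix.charpoly_natDegree_eq_dim, Fintype.card_fin] at this
    simpa using this

/-- Along W = t Zᵀ the trace is affine in t with slope tr(ZᵀZ), yet stability bounds it by d; so the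
slope vanishes. -/
theorem eq_zero_of_isSchurStable_add_mul {d : ℕ} {A Z : Matrix (Fin d) (Fin d) ℝ}
    (h : ∀ W : Matrix (Fin d) (Fin d) ℝ, IsSchurStable (toComplex (A + W * Z))) : Z = 0 := by
  have htr : ∀ t : ℝ, |A.trace + t * (Z.transpose * Z).trace| ≤ d := by
    intro t
    have h1 := (h (t • Z.transpose)).norm_trace_le
    have h2 : (toComplex (A + t • Z.transpose * Z)).trace
        = ((A.trace + t * (Z.transpose * Z).trace : ℝ) : ℂ) := by
      have h3 : (A + t • Z.transpose * Z).trace = A.trace + t * (Z.transpose * Z).trace := by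
        rw [Matrix.trace_add, Matrix.smul_mul, Matrix.trace_smul, smul_eq_mul]
      rw [← h3]
      simp [toComplex, Matrix.trace]
    rw [h2, Complex.norm_real] at h1
    exact h1
  have h0 : (Z.transpose * Z).trace = 0 := by
    by_contra hne
    -- This t makes the trace equal to d + 1.
    have := htr ((d + 1 - A.trace) / (Z.transpose * Z).trace)
    rw [div_mul_cancel₀ _ hne, add_sub_cancel, abs_of_nonneg (by positivity)] at this
    linarith
  exact Matrix.trace_conjTranspose_mul_self_eq_zero_iff.1
    (by rwa [Matrix.conjTranspose_eq_transpose_of_trivial])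

/-- Column by column: a vector outside the range of [X; U] is separated from it by a functional,
whose coordinates form a pair (a, b) violating the hypothesis. -/
theorem exists_mul_eq_mul_eq_of_annihilator_le {d e τ q : ℕ} {X : Matrix (Fin d) (Fin τ) ℝ}
    {U : Matrix (Fin e) (Fin τ) ℝ} {Y : Matrix (Fin d) (Fin q) ℝ} {Z : Matrix (Fin e) (Fin q) ℝ}
    (h : ∀ (a : Fin d → ℝ) (b : Fin e → ℝ), Matrix.vecMul a X + Matrix.vecMul b U = 0 →
      Matrix.vecMul a Y + Matrix.vecMul b Z = 0) :
    ∃ M : Matrix (Fin τ) (Fin q) ℝ, X * M = Y ∧ U * M = Z := by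
  have hcol : ∀ j : Fin q, ∃ c : Fin τ → ℝ, X.mulVec c = Y.col j ∧ U.mulVec c = Z.col j := by
    intro j
    have hmem : (Y.col j, Z.col j) ∈ LinearMap.range (X.mulVecLin.prod U.mulVecLin) := by
      by_contra hn
      obtain ⟨f, hf, hker⟩ := Submodule.exists_le_ker_of_notMem hn
      set a : Fin d → ℝ := fun i => f (Pi.single i 1, 0)
      set b : Fin e → ℝ := fun i => f (0, Pi.single i 1)
      have hfe : ∀ x y, f (x, y) = a ⬝ᵥ x + b ⬝ᵥ y := by
        intro x y
        have h1 : f (x, y) = (f ∘ₗ LinearMap.inl ℝ _ _) x + (f ∘ₗ LinearMap.inr ℝ _ _) y := by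
          simp [← map_add]
        rw [h1, LinearMap.pi_apply_eq_sum_univ (f ∘ₗ LinearMap.inl ℝ _ _) x,
          LinearMap.pi_apply_eq_sum_univ (f ∘ₗ LinearMap.inr ℝ _ _) y]
        simp only [dotProduct, a, b, smul_eq_mul, LinearMap.comp_apply, LinearMap.inl_apply,
          LinearMap.inr_apply]
        congr 1 <;> refine Finset.sum_congr rfl fun i _ => ?_ <;> rw [mul_comm] <;> congr 3 <;>
          ext k <;> simp [Pi.single_apply, eq_comm]
      have hann := h a b (by
        ext k
        have h1 : f (X.mulVec (Pi.single k 1), U.mulVec (Pi.single k 1)) = 0 :=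
          hker ⟨Pi.single k 1, rfl⟩
        rw [hfe, Matrix.mulVec_single_one, Matrix.mulVec_single_one] at h1
        exact h1)
      apply hf
      rw [hfe]
      exact congrFun hann j
    obtain ⟨c, hc⟩ := hmem
    exact ⟨c, congrArg Prod.fst hc, congrArg Prod.snd hc⟩
  choose c hc1 hc2 using hcol
  refine ⟨Matrix.of fun k j => c j k, ?_, ?_⟩
  · ext i j
    exact congrFun (hc1 j) i
  · ext i j
    exact congrFun (hc2 j) i

/-! ### Coupled dynamics and cascades -/

section BlockSystems

variable {N r : ℕ}

/-- Apply a matrix to every component of a family of vectors. -/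
noncomputable def applyRows (N : ℕ) {r : ℕ} (S : Matrix (Fin r) (Fin r) ℂ) :
    Module.End ℂ (Fin N → Fin r → ℂ) :=
  LinearMap.pi fun i => S.mulVecLin ∘ₗ LinearMap.proj i

/-- Form the linear combinations of a family of vectors given by the rows of a matrix. -/
noncomputable def mixRows {N : ℕ} (r : ℕ) (c : Matrix (Fin N) (Fin N) ℂ) :
    Module.End ℂ (Fin N → Fin r → ℂ) :=
  LinearMap.pi fun i => ∑ j, c i j • LinearMap.proj j

theorem applyRows_apply (S : Matrix (Fin r) (Fin r) ℂ) (w : Fin N → Fin r → ℂ) (i : Fin N) :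
    applyRows N S w i = S.mulVec (w i) := rfl

theorem mixRows_apply (c : Matrix (Fin N) (Fin N) ℂ) (w : Fin N → Fin r → ℂ) (i : Fin N) :
    mixRows r c w i = ∑ j, c i j • w j := by
  simp [mixRows]

theorem commute_applyRows_mixRows (S : Matrix (Fin r) (Fin r) ℂ) (c : Matrix (Fin N) (Fin N) ℂ) :
    Commute (applyRows N S) (mixRows r c) := by
  refine LinearMap.ext fun w => funext fun i => ?_
  simp only [Module.End.mul_apply, applyRows_apply, mixRows_apply, Matrix.mulVec_sum,
    Matrix.mulVec_smul]

/-- The operator commutes with the mixing by c, so its ν-eigenspace contains an eigenvector of the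
mixing, with eigenvalue z say. On it the mixing is the scalar z: any nonzero component is an
eigenvector of S - zF for ν, and a nonzero coordinate slice shows that z is an eigenvalue of c. -/
theorem norm_lt_one_of_hasEigenvalue_applyRows_sub {S F : Matrix (Fin r) (Fin r) ℂ}
    {c : Matrix (Fin N) (Fin N) ℂ} (h : ∀ z ∈ spectrum ℂ c, IsSchurStable (S - z • F))
    {ν : ℂ} (hν : Module.End.HasEigenvalue (applyRows N S - applyRows N F * mixRows r c) ν) :
    ‖ν‖ < 1 := by
  set T := applyRows N S - applyRows N F * mixRows r c
  have hcomm : Commute T (mixRows r c) :=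
    (commute_applyRows_mixRows S c).sub_left
      ((commute_applyRows_mixRows F c).mul_left (Commute.refl _))
  have hinv : ∀ w ∈ T.eigenspace ν, mixRows r c w ∈ T.eigenspace ν := by
    intro w hw
    rw [Module.End.mem_eigenspace_iff] at hw ⊢
    rw [← Module.End.mul_apply, hcomm.eq, Module.End.mul_apply, hw, map_smul]
  have : Nontrivial (T.eigenspace ν) := Submodule.nontrivial_iff_ne_bot.2 hν
  obtain ⟨z, hz⟩ := Module.End.exists_eigenvalue ((mixRows r c).restrict hinv)
  obtain ⟨w, hw⟩ := hz.exists_hasEigenvector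
  have hmix : mixRows r c w = z • (w : Fin N → Fin r → ℂ) := by
    simpa using congrArg Subtype.val hw.apply_eq_smul
  have hT : T w = ν • (w : Fin N → Fin r → ℂ) := Module.End.mem_eigenspace_iff.1 w.2
  have hw0 : (w : Fin N → Fin r → ℂ) ≠ 0 := fun h0 => hw.2 (Subtype.ext h0)
  generalize (w : Fin N → Fin r → ℂ) = w at hmix hT hw0
  obtain ⟨i, hi⟩ := Function.ne_iff.1 hw0
  obtain ⟨a, ha⟩ := Function.ne_iff.1 hi
  have hzc : z ∈ spectrum ℂ c := by
    refine Matrix.mem_spectrum_iff_exists_mulVec.2 ⟨fun j => w j a, ?_, ?_⟩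
    · exact fun h0 => ha (congrFun h0 i)
    · ext j
      have := congrFun (congrFun hmix j) a
      rw [mixRows_apply] at this
      simpa [Matrix.mulVec, dotProduct] using this
  refine h z hzc ν (Matrix.mem_spectrum_iff_exists_mulVec.2 ⟨w i, hi, ?_⟩)
  have h1 : applyRows N S w i - applyRows N F (mixRows r c w) i = ν • w i := congrFun hT i
  rw [hmix, applyRows_apply, applyRows_apply, Pi.smul_apply, Matrix.mulVec_smul] at h1
  rw [Matrix.sub_mulVec, Matrix.smul_mulVec, h1]

/-- The joint map on V × W is block triangular, so each of its eigenvalues belongs to f or to g. -/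
theorem tendsto_zero_of_cascade {V W : Type*} [NormedAddCommGroup V] [NormedSpace ℂ V]
    [FiniteDimensional ℂ V] [NormedAddCommGroup W] [NormedSpace ℂ W] [FiniteDimensional ℂ W]
    {f : Module.End ℂ V} {h : W →ₗ[ℂ] V} {g : Module.End ℂ W}
    (hf : ∀ z, f.HasEigenvalue z → ‖z‖ < 1) (hg : ∀ z, g.HasEigenvalue z → ‖z‖ < 1)
    {x : ℕ → V} {y : ℕ → W} (hx : ∀ k, x (k + 1) = f (x k) + h (y k))
    (hy : ∀ k, y (k + 1) = g (y k)) :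
    Tendsto x atTop (𝓝 0) ∧ Tendsto y atTop (𝓝 0) := by
  set T : Module.End ℂ (V × W) :=
    (f ∘ₗ LinearMap.fst ℂ V W + h ∘ₗ LinearMap.snd ℂ V W).prod (g ∘ₗ LinearMap.snd ℂ V W)
  have hT : ∀ z, T.HasEigenvalue z → ‖z‖ < 1 := by
    intro z hz
    obtain ⟨⟨a, b⟩, hab⟩ := hz.exists_hasEigenvector
    have heq := hab.apply_eq_smul
    have h1 : f a + h b = z • a := congrArg Prod.fst heq
    have h2 : g b = z • b := congrArg Prod.snd heq
    by_cases hb : b = 0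
    · subst hb
      have ha : a ≠ 0 := fun ha => hab.2 (by rw [ha]; rfl)
      exact hf z (Module.End.hasEigenvalue_of_hasEigenvector (x := a)
        ⟨Module.End.mem_eigenspace_iff.2 (by simpa using h1), ha⟩)
    · exact hg z (Module.End.hasEigenvalue_of_hasEigenvector (x := b)
        ⟨Module.End.mem_eigenspace_iff.2 h2, hb⟩)
  have hxy : ∀ k, (x k, y k) = (T ^ k) (x 0, y 0) := by
    intro k
    induction k with
    | zero => simp
    | succ k ih =>
      rw [pow_succ', Module.End.mul_apply, ← ih, hx, hy]
      rfl
  have hlim := tendsto_pow_apply_zero_of_eigenvalue_norm_lt_one T hT (x 0, y 0)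
  simp only [← hxy] at hlim
  exact ⟨(continuous_fst.tendsto _).comp hlim, (continuous_snd.tendsto _).comp hlim⟩

end BlockSystems

theorem tendsto_zero_of_tendsto_ofReal {a : ℕ} {x : ℕ → Fin a → ℝ}
    (h : Tendsto (fun k j => (x k j : ℂ)) atTop (𝓝 0)) : Tendsto x atTop (𝓝 0) := by
  refine tendsto_pi_nhds.2 fun j => ?_
  have := (Complex.continuous_re.tendsto _).comp (tendsto_pi_nhds.1 h j)
  simpa [Function.comp_def] using this

theorem tendsto_mulVec_zero {a b : ℕ} (A : Matrix (Fin a) (Fin b) ℝ) {x : ℕ → Fin b → ℝ}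
    (h : Tendsto x atTop (𝓝 0)) : Tendsto (fun k => A.mulVec (x k)) atTop (𝓝 0) := by
  have h1 := ((Continuous.matrix_mulVec continuous_const continuous_id).tendsto 0).comp
    (g := fun x => A.mulVec x) h
  simpa [Function.comp_def] using h1

/-! ### The coupling matrix and the existence of a gain -/

namespace LeaderFollowerNetwork

variable {N r p : ℕ} {n m : Fin N → ℕ} (net : LeaderFollowerNetwork N r p n m)

theorem weight_pos (i : Fin N) : 0 < 1 + net.graph.degree i + net.g i := by
  have h1 : 0 ≤ net.graph.degree i := Finset.sum_nonneg fun j _ => net.graph.adj_nonneg i j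
  have h2 := net.g_nonneg i
  linarith

theorem couplingMatrix_apply (i j : Fin N) :
    net.couplingMatrix i j = (1 + net.graph.degree i + net.g i)⁻¹ *
      (Matrix.diagonal (fun i => net.graph.degree i + net.g i) i j - net.graph.adj i j) := by
  have hinv : (1 + net.graph.degreeMatrix + Matrix.diagonal net.g)⁻¹
      = Matrix.diagonal fun i => (1 + net.graph.degree i + net.g i)⁻¹ := by
    refine Matrix.inv_eq_left_inv ?_
    rw [WeightedDigraph.degreeMatrix, ← Matrix.diagonal_one, Matrix.diagonal_add,
      Matrix.diagonal_add, Matrix.diagonal_mul_diagonal]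
    congr 1
    ext i
    exact inv_mul_cancel₀ (net.weight_pos i).ne'
  rw [couplingMatrix, hinv, Matrix.diagonal_mul, WeightedDigraph.laplacian,
    WeightedDigraph.degreeMatrix, Matrix.add_apply, Matrix.sub_apply, ← Matrix.diagonal_add,
    Matrix.add_apply]
  ring

theorem sum_couplingMatrix_smul {E : Type*} [AddCommGroup E] [Module ℝ E] (w : Fin N → E)
    (i : Fin N) :
    ∑ j, net.couplingMatrix i j • w j = (1 + net.graph.degree i + net.g i)⁻¹ •
      ((net.graph.degree i + net.g i) • w i - ∑ j, net.graph.adj i j • w j) := by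
  simp only [couplingMatrix_apply, mul_smul, sub_smul, ← Finset.smul_sum, Finset.sum_sub_distrib,
    Matrix.diagonal_apply, ite_smul, zero_smul, Finset.sum_ite_eq, Finset.mem_univ, if_true]

/-- Maximum principle: if |1 - z| ≥ 1, then at a node where an eigenvector has maximal modulus the
triangle inequality must be an equality. Hence g vanishes there and all in-neighbours are maximal
too. Following the tree backwards reaches the root, where g > 0. -/
theorem norm_one_sub_lt_one_of_mem_spectrum_couplingMatrix (hG : net.CommunicationAssumption)
    {z : ℂ} (hz : z ∈ spectrum ℂ (toComplex net.couplingMatrix)) : ‖1 - z‖ < 1 := by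
  obtain ⟨-, T, root, hT, hroot⟩ := hG
  obtain ⟨w, hw0, hw⟩ := Matrix.mem_spectrum_iff_exists_mulVec.1 hz
  by_contra! hz1
  have hrow : ∀ i, (1 + net.graph.degree i + net.g i) • ((1 - z) * w i)
      = w i + ∑ j, net.graph.adj i j • w j := by
    intro i
    have h1 : ∑ j, net.couplingMatrix i j • w j = z * w i := by
      simpa [Matrix.mulVec, dotProduct, toComplex] using congrFun hw i
    rw [sum_couplingMatrix_smul, inv_smul_eq_iff₀ (net.weight_pos i).ne'] at h1
    rw [sub_mul, one_mul, smul_sub, ← h1, add_assoc, add_smul, one_smul]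
    abel
  have : Nonempty (Fin N) := ⟨root⟩
  obtain ⟨i₀, hi₀⟩ := Finite.exists_max fun i => ‖w i‖
  have hpos : 0 < ‖w i₀‖ := by
    obtain ⟨i, hi⟩ := Function.ne_iff.1 hw0
    exact (norm_pos_iff.2 hi).trans_le (hi₀ i)
  have hstep : ∀ i, ‖w i‖ = ‖w i₀‖ →
      net.g i = 0 ∧ ∀ j, net.graph.Edge j i → ‖w j‖ = ‖w i₀‖ := by
    intro i hi
    have h1 : (1 + net.graph.degree i + net.g i) * ‖w i₀‖
        ≤ ‖w i₀‖ + ∑ j, net.graph.adj i j * ‖w j‖ := by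
      calc (1 + net.graph.degree i + net.g i) * ‖w i₀‖
          ≤ (1 + net.graph.degree i + net.g i) * (‖1 - z‖ * ‖w i₀‖) :=
            mul_le_mul_of_nonneg_left (le_mul_of_one_le_left hpos.le hz1) (net.weight_pos i).le
        _ = ‖w i + ∑ j, net.graph.adj i j • w j‖ := by
            rw [← hrow, norm_smul, norm_mul, hi, Real.norm_of_nonneg (net.weight_pos i).le]
        _ ≤ ‖w i₀‖ + ∑ j, net.graph.adj i j * ‖w j‖ := by
            refine (norm_add_le _ _).trans (add_le_add hi.le ((norm_sum_le _ _).trans ?_))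
            refine Finset.sum_le_sum fun j _ => ?_
            rw [norm_smul, Real.norm_of_nonneg (net.graph.adj_nonneg i j)]
    have h2 : ∑ j, net.graph.adj i j * (‖w i₀‖ - ‖w j‖)
        = net.graph.degree i * ‖w i₀‖ - ∑ j, net.graph.adj i j * ‖w j‖ := by
      rw [WeightedDigraph.degree, Finset.sum_mul, ← Finset.sum_sub_distrib]
      simp only [mul_sub]
    have h3 : ∀ j ∈ Finset.univ, 0 ≤ net.graph.adj i j * (‖w i₀‖ - ‖w j‖) := fun j _ =>
      mul_nonneg (net.graph.adj_nonneg i j) (sub_nonneg.2 (hi₀ j))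
    have h4 := Finset.sum_nonneg h3
    have h5 : 0 ≤ net.g i * ‖w i₀‖ := mul_nonneg (net.g_nonneg i) hpos.le
    have h6 : net.g i * ‖w i₀‖ = 0 := by linarith
    have h7 : ∑ j, net.graph.adj i j * (‖w i₀‖ - ‖w j‖) = 0 := by linarith
    refine ⟨(mul_eq_zero.1 h6).resolve_right hpos.ne', fun j hj => ?_⟩
    have h8 := (Finset.sum_eq_zero_iff_of_nonneg h3).1 h7 j (Finset.mem_univ j)
    linarith [(mul_eq_zero.1 h8).resolve_left hj]
  have hmax : ‖w root‖ = ‖w i₀‖ := by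
    refine Relation.ReflTransGen.head_induction_on (motive := fun i _ => ‖w i‖ = ‖w i₀‖)
      (hT.reachable i₀) rfl fun {i j} hij _ hj => ?_
    exact (hstep j hj).2 i (hT.edge i j hij)
  exact hroot.ne' (hstep root hmax).1

/-- S - zS = (1 - z)S, whose eigenvalues have modulus |1 - z| < 1. -/
theorem isStabilizingGain_self (hS : EigenvaluesSimpleOnUnitCircle net.S)
    (hG : net.CommunicationAssumption) : net.IsStabilizingGain net.S := by
  intro z hz ν hν
  have hlt := net.norm_one_sub_lt_one_of_mem_spectrum_couplingMatrix hG hz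
  obtain ⟨w, hw0, hw⟩ := Matrix.mem_spectrum_iff_exists_mulVec.1 hν
  have h1 : (1 - z) • (toComplex net.S).mulVec w = ν • w := by
    rw [← hw, Matrix.sub_mulVec, Matrix.smul_mulVec, sub_smul, one_smul]
  by_cases hz1 : 1 - z = 0
  · rw [hz1, zero_smul] at h1
    rw [(smul_eq_zero.1 h1.symm).resolve_right hw0]
    simp
  · have h2 : ((1 - z)⁻¹ * ν) ∈ spectrum ℂ (toComplex net.S) := by
      refine Matrix.mem_spectrum_iff_exists_mulVec.2 ⟨w, hw0, ?_⟩
      rw [mul_smul, ← h1, inv_smul_smul₀ hz1]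
    have h3 := (hS _ h2).2
    rw [norm_mul, norm_inv, inv_mul_eq_one₀ (norm_ne_zero_iff.2 hz1)] at h3
    rwa [← h3]

/-! ### Trajectories: error dynamics and sufficiency -/

variable {net} {P : Protocol N r n m} {A : ∀ i, Matrix (Fin (n i)) (Fin (n i)) ℝ}
  {B : ∀ i, Matrix (Fin (n i)) (Fin (m i)) ℝ}

theorem IsTrajectory.controller_eq {xr : ℕ → Fin r → ℝ} {x : ∀ i, ℕ → Fin (n i) → ℝ}
    {u : ∀ i, ℕ → Fin (m i) → ℝ} {v : Fin N → ℕ → Fin r → ℝ}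
    (h : net.IsTrajectory P A B xr x u v) (i : Fin N) (k : ℕ) :
    v i (k + 1) = net.S.mulVec (v i k) -
      P.F.mulVec (∑ j, net.couplingMatrix i j • (v j k - xr k)) := by
  rw [h.controller, sum_couplingMatrix_smul, Matrix.mulVec_smul, sub_eq_add_neg _ (_ • _),
    ← smul_neg, ← Matrix.mulVec_neg]
  have h1 : ∀ w : Fin r → ℝ, ∑ j, net.graph.adj i j • (v j k - w)
      = ∑ j, net.graph.adj i j • v j k - net.graph.degree i • w := by
    intro w
    simp only [smul_sub, Finset.sum_sub_distrib, WeightedDigraph.degree, Finset.sum_smul]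
  rw [h1, h1]
  congr 3
  module

theorem achievesOutputSync_of_regulator_equations
    (hF : net.IsStabilizingGain P.F)
    (hA : ∀ i, IsSchurStable (toComplex (A i + B i * P.K i)))
    (hreg : ∀ i, A i * P.Pi i + B i * P.Gam i = P.Pi i * net.S)
    (hout : ∀ i, net.C i * P.Pi i + net.D i * P.Gam i = net.R) :
    net.AchievesOutputSync P A B := by
  intro xr x u v h i
  set e : ℕ → Fin (n i) → ℝ := fun k => x i k - (P.Pi i).mulVec (v i k) with he
  set δ : ℕ → Fin N → Fin r → ℝ := fun k j => v j k - xr k with hδ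
  have hδ_succ : ∀ k j, δ (k + 1) j = net.S.mulVec (δ k j)
      - P.F.mulVec (∑ l, net.couplingMatrix j l • δ k l) := by
    intro k j
    simp only [hδ]
    rw [h.controller_eq, h.leader, Matrix.mulVec_sub]
    abel
  have hxu : ∀ k, x i k = e k + (P.Pi i).mulVec (v i k) := fun k => by simp [he]
  have hu : ∀ k, u i k = (P.K i).mulVec (e k) + (P.Gam i).mulVec (v i k) := fun k => h.input i k
  have he_succ : ∀ k, e (k + 1) = (A i + B i * P.K i).mulVec (e k)
      + (P.Pi i * P.F).mulVec (∑ l, net.couplingMatrix i l • δ k l) := by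
    intro k
    have h1 : e (k + 1) = x i (k + 1) - (P.Pi i).mulVec (v i (k + 1)) := rfl
    rw [h1, h.follower, h.controller_eq, hu, hxu, Matrix.mulVec_sub (P.Pi i),
      Matrix.mulVec_mulVec _ (P.Pi i) net.S, ← hreg]
    simp only [Matrix.mulVec_add, Matrix.add_mulVec, Matrix.mulVec_mulVec]
    abel
  have hsum : ∀ k j, ∑ l, toComplex net.couplingMatrix j l • (fun a => (δ k l a : ℂ))
      = fun a => (((∑ l, net.couplingMatrix j l • δ k l) a : ℝ) : ℂ) := by
    intro k j
    ext a
    simp [toComplex]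
  have hlim := tendsto_zero_of_cascade
    (f := (toComplex (A i + B i * P.K i)).mulVecLin)
    (g := applyRows N (toComplex net.S)
      - applyRows N (toComplex P.F) * mixRows r (toComplex net.couplingMatrix))
    (h := (toComplex (P.Pi i * P.F)).mulVecLin ∘ₗ LinearMap.proj i ∘ₗ
      mixRows r (toComplex net.couplingMatrix))
    (x := fun k a => (e k a : ℂ)) (y := fun k j a => (δ k j a : ℂ))
    (fun z hz => hA i z (by
      rw [← Matrix.spectrum_toLin']
      exact Module.End.hasEigenvalue_iff_mem_spectrum.1 hz))
    (fun z hz => norm_lt_one_of_hasEigenvalue_applyRows_sub hF hz)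
    (fun k => by
      simp only [LinearMap.comp_apply, LinearMap.proj_apply, Matrix.mulVecLin_apply,
        mixRows_apply, hsum, toComplex_mulVec, he_succ]
      ext a
      simp)
    (fun k => by
      refine funext fun j => ?_
      simp only [LinearMap.sub_apply, Module.End.mul_apply, Pi.sub_apply, applyRows_apply,
        mixRows_apply, hsum, toComplex_mulVec, hδ_succ]
      ext a
      simp)
  have he0 : Tendsto e atTop (𝓝 0) := tendsto_zero_of_tendsto_ofReal hlim.1
  have hδ0 : Tendsto (fun k => δ k i) atTop (𝓝 0) :=
    tendsto_zero_of_tendsto_ofReal (tendsto_pi_nhds.1 hlim.2 i)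
  refine ⟨?_, hδ0, he0⟩
  -- By CΠ + DΓ = R the output error is (C + DK)e + Rδ.
  have hy := (tendsto_mulVec_zero (net.C i + net.D i * P.K i) he0).add
    (tendsto_mulVec_zero net.R hδ0)
  rw [add_zero] at hy
  refine hy.congr fun k => ?_
  rw [hu, hxu]
  simp only [hδ, Matrix.mulVec_sub]
  rw [← hout i]
  simp only [Matrix.mulVec_add, Matrix.add_mulVec, Matrix.mulVec_mulVec]
  abel

/-! ### Test trajectories and necessity -/

/-- Once all v_i equal x_r the correction terms vanish and they stay equal, whatever F is; follower
states remain free. -/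
theorem exists_isTrajectory_of_leader (net : LeaderFollowerNetwork N r p n m)
    (P : Protocol N r n m) (A : ∀ i, Matrix (Fin (n i)) (Fin (n i)) ℝ)
    (B : ∀ i, Matrix (Fin (n i)) (Fin (m i)) ℝ) (w : Fin r → ℝ) (x₀ : ∀ i, Fin (n i) → ℝ) :
    ∃ x u, net.IsTrajectory P A B (fun k => (net.S ^ k).mulVec w) x u
      (fun _ k => (net.S ^ k).mulVec w) ∧ ∀ i, x i 0 = x₀ i := by
  let input : ∀ i, ℕ → (Fin (n i) → ℝ) → Fin (m i) → ℝ := fun i k y =>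
    (P.K i).mulVec (y - (P.Pi i).mulVec ((net.S ^ k).mulVec w))
      + (P.Gam i).mulVec ((net.S ^ k).mulVec w)
  let x : ∀ i, ℕ → Fin (n i) → ℝ := fun i k =>
    Nat.rec (x₀ i) (fun k y => (A i).mulVec y + (B i).mulVec (input i k y)) k
  refine ⟨x, fun i k => input i k (x i k), ⟨fun k => ?_, fun i k => rfl, fun i k => ?_,
    fun i k => rfl⟩, fun i => rfl⟩
  · rw [pow_succ', Matrix.mulVec_mulVec]
  · simp [pow_succ', Matrix.mulVec_mulVec]

theorem AchievesOutputSync.isSchurStable (h : net.AchievesOutputSync P A B) (i : Fin N) :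
    IsSchurStable (toComplex (A i + B i * P.K i)) := by
  refine isSchurStable_toComplex_of_tendsto fun y => ?_
  obtain ⟨x, u, htr, hx0⟩ := net.exists_isTrajectory_of_leader P A B 0
    (Function.update (fun _ => 0) i y)
  have h1 := (h _ _ _ _ htr i).2.2
  simp only [Matrix.mulVec_zero, sub_zero] at h1
  refine h1.congr fun k => ?_
  induction k with
  | zero => simp [hx0]
  | succ k ih =>
    rw [htr.follower, htr.input, ih, pow_succ', ← Matrix.mulVec_mulVec]
    simp [Matrix.add_mulVec, Matrix.mulVec_mulVec, Matrix.add_mul, Matrix.mul_assoc]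

theorem AchievesOutputSync.regulator_equations (hS : EigenvaluesSimpleOnUnitCircle net.S)
    (h : net.AchievesOutputSync P A B) (i : Fin N) :
    A i * P.Pi i + B i * P.Gam i = P.Pi i * net.S ∧
      net.C i * P.Pi i + net.D i * P.Gam i = net.R := by
  have hS1 : ∀ z ∈ spectrum ℂ (toComplex net.S), 1 ≤ ‖z‖ := fun z hz => (hS z hz).2.ge
  constructor <;> rw [← sub_eq_zero] <;> refine eq_zero_of_tendsto_mul_pow hS1 fun w => ?_ <;>
    obtain ⟨x, u, htr, -⟩ := net.exists_isTrajectory_of_leader P A B w 0 <;>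
    obtain ⟨hy, -, he⟩ := h _ _ _ _ htr i
  -- Along v = S^k w, e(k+1) - (A + BK)e(k) = (AΠ + BΓ - ΠS)S^k w.
  · have h1 := ((tendsto_add_atTop_iff_nat 1).2 he).sub
      (tendsto_mulVec_zero (A i + B i * P.K i) he)
    rw [sub_zero] at h1
    refine h1.congr fun k => ?_
    rw [htr.follower, htr.input, pow_succ']
    simp only [Matrix.mulVec_add, Matrix.add_mulVec, Matrix.sub_mulVec, Matrix.mulVec_sub,
      Matrix.mulVec_mulVec, Matrix.mul_assoc, Matrix.add_mul, Matrix.sub_mul]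
    abel
  -- Likewise y - y_r - (C + DK)e = (CΠ + DΓ - R)S^k w.
  · have h1 := hy.sub (tendsto_mulVec_zero (net.C i + net.D i * P.K i) he)
    rw [sub_zero] at h1
    refine h1.congr fun k => ?_
    rw [htr.input]
    simp only [Matrix.mulVec_add, Matrix.add_mulVec, Matrix.sub_mulVec, Matrix.mulVec_sub,
      Matrix.mulVec_mulVec, Matrix.mul_assoc, Matrix.add_mul, Matrix.sub_mul]
    abel

/-- A protocol that works for all systems explaining the data satisfies the stability condition and
the regulator equations for each of these systems separately. -/
theorem AchievesOutputSyncForData.of_mem_explainingSystems {τ : ℕ}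
    {U : ∀ i, Matrix (Fin (m i)) (Fin τ) ℝ} {X : ∀ i, Matrix (Fin (n i)) (Fin (τ + 1)) ℝ}
    (hS : EigenvaluesSimpleOnUnitCircle net.S) (h : net.AchievesOutputSyncForData U X P)
    (hdata : ∀ i, (A i, B i) ∈ explainingSystems (U i) (X i)) {i : Fin N}
    {A' : Matrix (Fin (n i)) (Fin (n i)) ℝ} {B' : Matrix (Fin (n i)) (Fin (m i)) ℝ}
    (hAB : (A', B') ∈ explainingSystems (U i) (X i)) :
    IsSchurStable (toComplex (A' + B' * P.K i)) ∧
      A' * P.Pi i + B' * P.Gam i = P.Pi i * net.S ∧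
      net.C i * P.Pi i + net.D i * P.Gam i = net.R := by
  have hsync := h (Function.update A i A') (Function.update B i B') fun j => by
    by_cases hj : j = i
    · subst hj
      simpa using hAB
    · simpa [Function.update_of_ne hj] using hdata j
  have h1 := hsync.isSchurStable i
  have h2 := hsync.regulator_equations hS i
  simp only [Function.update_self] at h1 h2
  exact ⟨h1, h2⟩

theorem AchievesOutputSyncForData.data_conditions {τ : ℕ}
    {U : ∀ i, Matrix (Fin (m i)) (Fin τ) ℝ} {X : ∀ i, Matrix (Fin (n i)) (Fin (τ + 1)) ℝ}
    (hn : ∀ i, 0 < n i) (hS : EigenvaluesSimpleOnUnitCircle net.S)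
    (h : net.AchievesOutputSyncForData U X P)
    (hdata : ∀ i, (A i, B i) ∈ explainingSystems (U i) (X i)) (i : Fin N) :
    (∃ Xd, IsStabilizingRightInverse (X i) Xd) ∧
      ∃ M, SolvesDataRegulatorEquations net.S net.R (net.C i) (net.D i) (U i) (X i) M := by
  have hX : futureStates (X i) = A i * pastStates (X i) + B i * U i := hdata i
  obtain ⟨hstab, hreg, hout⟩ := h.of_mem_explainingSystems hS hdata (hdata i)
  have hmem : ∀ (a : Matrix (Fin (n i)) (Fin (n i)) ℝ) (b : Matrix (Fin (n i)) (Fin (m i)) ℝ),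
      a * pastStates (X i) + b * U i = 0 →
        (A i + a, B i + b) ∈ explainingSystems (U i) (X i) := by
    intro a b hab
    change futureStates (X i) = (A i + a) * pastStates (X i) + (B i + b) * U i
    rw [hX, Matrix.add_mul, Matrix.add_mul, add_add_add_comm, hab, add_zero]
  -- Annihilating pairs are closed under left multiplication by any W, so A + BK + W(a + bK) is
  -- always stable. The factor 1 gives the shape needed for `hrow` with Y = 1.
  have hK : ∀ (a : Matrix (Fin (n i)) (Fin (n i)) ℝ) (b : Matrix (Fin (n i)) (Fin (m i)) ℝ),
      a * pastStates (X i) + b * U i = 0 → a * 1 + b * P.K i = 0 := by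
    intro a b hab
    refine eq_zero_of_isSchurStable_add_mul (A := A i + B i * P.K i) fun W => ?_
    have h1 := (h.of_mem_explainingSystems hS hdata (hmem (W * a) (W * b) (by
      rw [Matrix.mul_assoc, Matrix.mul_assoc, ← Matrix.mul_add, hab, Matrix.mul_zero]))).1
    convert h1 using 2
    simp only [Matrix.mul_add, Matrix.add_mul, Matrix.mul_one, Matrix.mul_assoc]
    abel
  -- ΠS does not depend on the system, so the regulator equations of two explaining systems can be
  -- subtracted.
  have hPi : ∀ (a : Matrix (Fin (n i)) (Fin (n i)) ℝ) (b : Matrix (Fin (n i)) (Fin (m i)) ℝ),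
      a * pastStates (X i) + b * U i = 0 → a * P.Pi i + b * P.Gam i = 0 := by
    intro a b hab
    have h1 := (h.of_mem_explainingSystems hS hdata (hmem a b hab)).2.1
    rw [← hreg, Matrix.add_mul, Matrix.add_mul, add_add_add_comm] at h1
    exact left_eq_add.1 h1.symm
  have hrow : ∀ {q : ℕ} (Y : Matrix (Fin (n i)) (Fin q) ℝ) (Z : Matrix (Fin (m i)) (Fin q) ℝ),
      (∀ (a : Matrix (Fin (n i)) (Fin (n i)) ℝ) (b : Matrix (Fin (n i)) (Fin (m i)) ℝ),
        a * pastStates (X i) + b * U i = 0 → a * Y + b * Z = 0) →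
      ∃ M : Matrix (Fin τ) (Fin q) ℝ, pastStates (X i) * M = Y ∧ U i * M = Z := by
    intro q Y Z hYZ
    refine exists_mul_eq_mul_eq_of_annihilator_le fun a b hab => ?_
    -- A single annihilating row is repeated to fill matrices with n_i rows; n_i ≥ 1 allows reading
    -- it back from row 0.
    have h1 := hYZ (Matrix.of fun _ => a) (Matrix.of fun _ => b) (by
      ext j k
      exact congrFun hab k)
    ext k
    exact congrFun (congrFun h1 ⟨0, hn i⟩) k
  obtain ⟨Xd, hXd1, hXd2⟩ := hrow 1 (P.K i) hK
  obtain ⟨M, hM1, hM2⟩ := hrow (P.Pi i) (P.Gam i) hPi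
  refine ⟨⟨Xd, hXd1, ?_⟩, M, ?_, ?_⟩
  · rwa [hX, Matrix.add_mul, Matrix.mul_assoc, Matrix.mul_assoc, hXd1, hXd2, Matrix.mul_one]
  · rw [hX, Matrix.add_mul, Matrix.mul_assoc, Matrix.mul_assoc, hM1, hM2, hreg, sub_self]
  · rw [Matrix.mul_assoc, Matrix.mul_assoc, hM1, hM2, hout]

/-- For every explaining system, A + BK = (A X_- + B U_-) X_-† = X_+ X_-† and AΠ + BΓ = X_+ M, so
both depend on the data alone. -/
theorem achievesOutputSyncForData_of_data_conditions (net : LeaderFollowerNetwork N r p n m)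
    {τ : ℕ} {U : ∀ i, Matrix (Fin (m i)) (Fin τ) ℝ}
    {X : ∀ i, Matrix (Fin (n i)) (Fin (τ + 1)) ℝ} {F : Matrix (Fin r) (Fin r) ℝ}
    {Xd : ∀ i, Matrix (Fin τ) (Fin (n i)) ℝ} {M : ∀ _ : Fin N, Matrix (Fin τ) (Fin r) ℝ}
    (hF : net.IsStabilizingGain F) (hXd : ∀ i, IsStabilizingRightInverse (X i) (Xd i))
    (hM : ∀ i,
      SolvesDataRegulatorEquations net.S net.R (net.C i) (net.D i) (U i) (X i) (M i)) :
    net.AchievesOutputSyncForData U X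
      { F := F
        K := fun i => U i * Xd i
        Pi := fun i => pastStates (X i) * M i
        Gam := fun i => U i * M i } := by
  intro A B hAB
  have hX : ∀ i, futureStates (X i) = A i * pastStates (X i) + B i * U i := hAB
  refine achievesOutputSync_of_regulator_equations hF (fun i => ?_) (fun i => ?_) fun i => ?_
  · have h1 := (hXd i).2
    rwa [hX, Matrix.add_mul, Matrix.mul_assoc, Matrix.mul_assoc, (hXd i).1, Matrix.mul_one] at h1
  · have h1 := (hM i).1
    rw [hX, Matrix.add_mul, Matrix.mul_assoc, Matrix.mul_assoc, sub_eq_zero] at h1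
    exact h1
  · simpa only [Matrix.mul_assoc] using (hM i).2

end LeaderFollowerNetwork

theorem proposition3 {N r p τ : ℕ} {n m : Fin N → ℕ} (hn : ∀ i, 0 < n i)
    (net : LeaderFollowerNetwork N r p n m)
    (hS : EigenvaluesSimpleOnUnitCircle net.S)
    (hG : net.CommunicationAssumption)
    (U : ∀ i, Matrix (Fin (m i)) (Fin τ) ℝ)
    (X : ∀ i, Matrix (Fin (n i)) (Fin (τ + 1)) ℝ)
    (Abar : ∀ i, Matrix (Fin (n i)) (Fin (n i)) ℝ)
    (Bbar : ∀ i, Matrix (Fin (n i)) (Fin (m i)) ℝ)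
    (hdata : ∀ i, (Abar i, Bbar i) ∈ explainingSystems (U i) (X i)) :
    (net.InformativeForOutputSync U X ↔
      ∀ i, (∃ Xd, IsStabilizingRightInverse (X i) Xd) ∧
        ∃ M, SolvesDataRegulatorEquations net.S net.R (net.C i) (net.D i) (U i) (X i) M) ∧
    (∃ F, net.IsStabilizingGain F) ∧
    (∀ (F : Matrix (Fin r) (Fin r) ℝ) (Xd : ∀ i, Matrix (Fin τ) (Fin (n i)) ℝ)
        (M : ∀ _ : Fin N, Matrix (Fin τ) (Fin r) ℝ),
      net.IsStabilizingGain F →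
      (∀ i, IsStabilizingRightInverse (X i) (Xd i)) →
      (∀ i, SolvesDataRegulatorEquations net.S net.R (net.C i) (net.D i) (U i) (X i) (M i)) →
      net.AchievesOutputSyncForData U X
        { F := F
          K := fun i => U i * Xd i
          Pi := fun i => pastStates (X i) * M i
          Gam := fun i => U i * M i }) := by
  refine ⟨⟨fun ⟨P, hP⟩ => hP.data_conditions hn hS hdata, fun h => ?_⟩,
    ⟨net.S, net.isStabilizingGain_self hS hG⟩,
    fun F Xd M hF hXd hM => net.achievesOutputSyncForData_of_data_conditions hF hXd hM⟩
  choose Xd hXd using fun i => (h i).1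
  choose M hM using fun i => (h i).2
  exact ⟨_, net.achievesOutputSyncForData_of_data_conditions
    (net.isStabilizingGain_self hS hG) hXd hM⟩
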